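/- Let $\sigma\in C^1([0,\infty))$ with $\sigma(0)=\sigma'(0)=0$ and $\sigma(y),\sigma'(y)>0$ for $y>0$, let $K\in[0,1]$, let $p,q,\ell,\delta\in\mathbb R$ with $\ell,\delta>0$, and let $a,b$ be functions of $y\ge 0$. Let $\Omega\subset\mathbb R^2$ be the domain enclosed by three arcs $C_1\cup\Gamma\cup C_2$ of the following kind, and suppose that $\Omega\subset\{p\le x<\ell,\ 0\le y\le q\}$ and $\sup_\Omega x=\ell-\delta$. (i) $C_1$ is the graph $y=g(x)$, $0\le x\le x_0$ (with $x_0>0$), of a continuous function, continuously differentiable on $(0,x_0)$, that starts at the origin and ends at a point $(x_0,y_0)$ of the sonic curve, $x_0=\sigma(y_0)$. For $0<x<x_0$ it satisfies $\sigma(g(x))<x$, $dy/dx>0$ and $a(y)\,\frac{dy}{dx}+b(y)<0$. (ii) $\Gamma$ is a characteristic arc $x=\gamma(y)$, $y_0\le y\le y_1$ (with $y_0<y_1$), that starts at $(x_0,y_0)$, lies in $x\le\sigma(y)$, and satisfies $\frac{dx}{dy}=-\sqrt{\sigma(y)-x}$. (iii) $C_2$ is a continuous arc that runs from $(\gamma(y_1),y_1)$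 to the origin, along which $x$ is nondecreasing and $y$ is nonincreasing, and that meets $\Gamma$ only at $(\gamma(y_1),y_1)$. For $w=(w_1,w_2)$ put $$(L^*w)_1=[x-\sigma(y)]\,w_{1x}+(1-K)w_1+w_{2y},\qquad (L^*w)_2=w_{1y}-w_{2x},$$ $$\|w\|_*=\Big[\iint_\Omega\sigma'(y)(w_1^2+w_2^2)\,dx\,dy\Big]^{1/2},\qquad \|h\|^*=\Big[\iint_\Omega\frac1{\sigma'(y)}(h_1^2+h_2^2)\,dx\,dy\Big]^{1/2}.$$ Let $W$ be the space of pairs $w=(w_1,w_2)$ with $w_1,w_2\in C^1(\overline\Omega)$ such that $w$ vanishes at the origin, $w_1\,dx+w_2\,dy=0$ on $\Gamma$, $w_1=0$ on $\partial\Omega\setminus\Gamma$, and $\|L^*w\|^*<\infty$. Suppose that one of the following holds: (A) $0\le K\le\frac12$, $\ a(y)=K\big[y+\ell^{-1}\int_0^y\sigma(t)\,dt\big]$ and $b(y)=-\big[1+\sigma(y)/\ell\big]$; or (B) $0\le K\le1$, $\ \sigma(y)=y^2$, $\ a(y)=Ky$ and $b(y)=-\big[1+\sigma(y)/(2\ell)\big]$.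 Then there is a constant $k>0$ such that, for all $w\in W$, the norm $\|w\|_*$ is finite and $$k\,\|w\|_*\le\|L^*w\|^*.$$ -/

import Mathlib

open MeasureTheory Set

namespace ColdPlasma

/-- The standing assumptions on the function `σ` whose graph `x = σ(y)` is the sonic curve.
Only its values for `y ≥ 0` matter; a function that is `C¹` on `[0, ∞)` with
`σ(0) = σ'(0) = 0` extends by `0` to a `C¹` function on the line. -/
structure IsSonic (σ : ℝ → ℝ) : Prop where
  contDiff : ContDiff ℝ 1 σ
  zero : σ 0 = 0
  deriv_zero : deriv σ 0 = 0
  pos : ∀ y, 0 < y → 0 < σ y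
  deriv_pos : ∀ y, 0 < y → 0 < deriv σ y

/-- The three arcs bounding the domain.
* `C₁` is the graph `y = g(x)`, `0 ≤ x ≤ x₀`, from the origin to the point `(x₀, y₀)`;
* `Γ` is the graph `x = γ(y)`, `y₀ ≤ y ≤ y₁`, from `(x₀, y₀)` to `(γ(y₁), y₁)`;
* `C₂` is the path `c(t)`, `0 ≤ t ≤ 1`, from `(γ(y₁), y₁)` to the origin. -/
structure Arcs where
  x₀ : ℝ
  y₀ : ℝ
  y₁ : ℝ
  g : ℝ → ℝ
  γ : ℝ → ℝ
  c : ℝ → ℝ × ℝ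

namespace Arcs

/-- The arc `C₁`. -/
def C₁ (D : Arcs) : Set (ℝ × ℝ) := (fun x => (x, D.g x)) '' Icc 0 D.x₀

/-- The arc `Γ`. -/
def Γ (D : Arcs) : Set (ℝ × ℝ) := (fun y => (D.γ y, y)) '' Icc D.y₀ D.y₁

/-- The arc `C₂`. -/
def C₂ (D : Arcs) : Set (ℝ × ℝ) := D.c '' Icc 0 1

/-- The open region enclosed by `C₁ ∪ Γ ∪ C₂`: the points that lie strictly above and to the right
of the (downward and rightward running) arc `C₂`, strictly above `C₁`, and strictly below and to the
left of `Γ`. -/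
def region (D : Arcs) : Set (ℝ × ℝ) :=
  {z | (∃ t ∈ Icc (0 : ℝ) 1, (D.c t).1 < z.1 ∧ (D.c t).2 < z.2) ∧
    (0 < z.1 → z.1 < D.x₀ ∧ D.g z.1 < z.2) ∧
    z.2 < D.y₁ ∧ (D.y₀ ≤ z.2 → z.1 < D.γ z.2)}

/-- The geometric assumptions on the domain, for a sonic curve `x = σ(y)`, coefficients `a(y)`,
`b(y)`, and an enclosing rectangle `p ≤ x < ℓ`, `0 ≤ y ≤ q` whose right side is at distance `δ`
from the domain. -/
structure Admissible (D : Arcs) (σ a b : ℝ → ℝ) (p q ℓ δ : ℝ) : Prop where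
  ℓ_pos : 0 < ℓ
  δ_pos : 0 < δ
  subset_rectangle : D.region ⊆ Ico p ℓ ×ˢ Icc 0 q
  isLUB_fst : IsLUB (Prod.fst '' D.region) (ℓ - δ)
  x₀_pos : 0 < D.x₀
  /-- `C₁` is a continuous arc, `C¹` away from its endpoints, from the origin to `(x₀, y₀)`. -/
  g_cont : ContinuousOn D.g (Icc 0 D.x₀)
  g_smooth : ContDiffOn ℝ 1 D.g (Ioo 0 D.x₀)
  g_zero : D.g 0 = 0
  g_end : D.g D.x₀ = D.y₀
  /-- `dy/dx > 0` on `C₁`. -/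
  g_deriv : ∀ x ∈ Ioo 0 D.x₀, 0 < deriv D.g x
  /-- `a(y) dy/dx + b(y) < 0` on `C₁`. -/
  g_cond : ∀ x ∈ Ioo 0 D.x₀, a (D.g x) * deriv D.g x + b (D.g x) < 0
  /-- `C₁` runs in the elliptic half `x > σ(y)` and ends on the sonic curve. -/
  g_elliptic : ∀ x ∈ Ioo 0 D.x₀, σ (D.g x) < x
  sonic_end : σ D.y₀ = D.x₀
  /-- `Γ` is a characteristic `dx/dy = -√(σ(y) - x)` in the hyperbolic half `x ≤ σ(y)`. -/
  y₀_lt_y₁ : D.y₀ < D.y₁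
  γ_cont : ContinuousOn D.γ (Icc D.y₀ D.y₁)
  γ_start : D.γ D.y₀ = D.x₀
  γ_hyperbolic : ∀ y ∈ Icc D.y₀ D.y₁, D.γ y ≤ σ y
  γ_char : ∀ y ∈ Ioo D.y₀ D.y₁, HasDerivAt D.γ (-√(σ y - D.γ y)) y
  /-- `C₂` is a continuous arc with `dx ≥ 0` and `dy ≤ 0`. -/
  c_cont : ContinuousOn D.c (Icc 0 1)
  c_fst : MonotoneOn (fun t => (D.c t).1) (Icc 0 1)
  c_snd : AntitoneOn (fun t => (D.c t).2) (Icc 0 1)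
  c_start : D.c 0 = (D.γ D.y₁, D.y₁)
  c_end : D.c 1 = (0, 0)
  /-- `C₂` meets `Γ` only at its left endpoint. -/
  C₂_inter_Γ : D.C₂ ∩ D.Γ = {(D.γ D.y₁, D.y₁)}

end Arcs

/-- `∂f/∂x`. -/
noncomputable def partialX (f : ℝ × ℝ → ℝ) (z : ℝ × ℝ) : ℝ := fderiv ℝ f z (1, 0)

/-- `∂f/∂y`. -/
noncomputable def partialY (f : ℝ × ℝ → ℝ) (z : ℝ × ℝ) : ℝ := fderiv ℝ f z (0, 1)

/-- `(L*w)₁ = (x - σ(y)) ∂ₓw₁ + (1 - K) w₁ + ∂ᵧw₂`. -/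
noncomputable def adjoint₁ (σ : ℝ → ℝ) (K : ℝ) (w₁ w₂ : ℝ × ℝ → ℝ) (z : ℝ × ℝ) : ℝ :=
  (z.1 - σ z.2) * partialX w₁ z + (1 - K) * w₁ z + partialY w₂ z

/-- `(L*w)₂ = ∂ᵧw₁ - ∂ₓw₂`. -/
noncomputable def adjoint₂ (w₁ w₂ : ℝ × ℝ → ℝ) (z : ℝ × ℝ) : ℝ :=
  partialY w₁ z - partialX w₂ z

/-- The integrand `σ'(y) (u₁² + u₂²)` of the squared norm `‖u‖_*²`. -/
noncomputable def lowerDensity (σ : ℝ → ℝ) (u₁ u₂ : ℝ × ℝ → ℝ) (z : ℝ × ℝ) : ℝ :=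
  deriv σ z.2 * (u₁ z ^ 2 + u₂ z ^ 2)

/-- The integrand `(1 / σ'(y)) (h₁² + h₂²)` of the squared norm `‖h‖^*²`. -/
noncomputable def upperDensity (σ : ℝ → ℝ) (h₁ h₂ : ℝ × ℝ → ℝ) (z : ℝ × ℝ) : ℝ :=
  1 / deriv σ z.2 * (h₁ z ^ 2 + h₂ z ^ 2)

/-- The norm `‖u‖_*` over `Ω`. -/
noncomputable def lowerNorm (σ : ℝ → ℝ) (Ω : Set (ℝ × ℝ)) (u₁ u₂ : ℝ × ℝ → ℝ) : ℝ :=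
  √(∫ z in Ω, lowerDensity σ u₁ u₂ z)

/-- The norm `‖h‖^*` over `Ω`. -/
noncomputable def upperNorm (σ : ℝ → ℝ) (Ω : Set (ℝ × ℝ)) (h₁ h₂ : ℝ × ℝ → ℝ) : ℝ :=
  √(∫ z in Ω, upperDensity σ h₁ h₂ z)

/-- `f ∈ C¹(closure Ω)` for an open set `Ω`: `f` is continuous on the closure, differentiable in `Ω`,
and its derivative extends continuously to the closure. -/
def IsC1UpToBoundary (Ω : Set (ℝ × ℝ)) (f : ℝ × ℝ → ℝ) : Prop :=
  ContinuousOn f (closure Ω) ∧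
    ∃ f' : ℝ × ℝ → (ℝ × ℝ →L[ℝ] ℝ), ContinuousOn f' (closure Ω) ∧
      ∀ z ∈ Ω, HasFDerivAt f (f' z) z

/-- The space `W` of test pairs `(w₁, w₂)`. -/
structure IsTestPair (σ : ℝ → ℝ) (K : ℝ) (D : Arcs) (w₁ w₂ : ℝ × ℝ → ℝ) : Prop where
  smooth₁ : IsC1UpToBoundary D.region w₁
  smooth₂ : IsC1UpToBoundary D.region w₂
  origin₁ : w₁ (0, 0) = 0
  origin₂ : w₂ (0, 0) = 0
  /-- `w₁ dx + w₂ dy = 0` on `Γ`, pulled back by the parametrization `y ↦ (γ(y), y)`. -/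
  on_Γ : ∀ y ∈ Ioo D.y₀ D.y₁, w₁ (D.γ y, y) * deriv D.γ y + w₂ (D.γ y, y) = 0
  off_Γ : ∀ z ∈ frontier D.region \ D.Γ, w₁ z = 0
  finite : IntegrableOn (upperDensity σ (adjoint₁ σ K w₁ w₂) (adjoint₂ w₁ w₂)) D.region

end ColdPlasma

namespace ColdPlasma

/-! ### Integration along horizontal and vertical slices. -/

section Slicing

/-! The estimate is an energy argument with multipliers. Put `T = x - σ(y)` and pair `L*w` with `(A
w₁ + B w₂, -B T w₁ + A w₂)`, where `A`, `B` are the given `a`, `b`. The product is half the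
divergence of a field `(U, V)` quadratic in `w`, plus a quadratic form `Q(w)`. If the outward flux
of `(U, V)` is nonnegative and `Q ≥ κ σ' |w|²`, then `κ ‖w‖_*²` is at most the integral of the
product, and a weighted Cauchy-Schwarz inequality absorbs half of it.

On `Γ` the condition on `w` makes the flux vanish, because `Γ` is characteristic. Off `Γ` the
condition `w₁ = 0` leaves `U = -A w₂²`, `V = B w₂²`; the flux through `C₂` then has the right sign
since `A ≥ 0 ≥ B`, and through `C₁` since `a dy/dx + b < 0`. All this is
`exists_mul_lowerNorm_le_upperNorm`.

Because `C₂` is only a monotone continuous arc, no line integral along it is used. In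
`integral_divergence_nonneg`, `U_x` is integrated along horizontal slices and `V_y` along vertical
ones. Endpoints on `C₂` are discarded by sign, and the remaining ones are matched on `Γ` and `C₁` by
the changes of variables `x = γ(y)` and `y = g(x)`.

It remains to check that `Q` is coercive. In case (A) the cross term cancels; in case (B) it is
absorbed by completing a square. -/

theorem eq_Ioo_of_isOpen_of_ordConnected {s : Set ℝ} (ho : IsOpen s) (hc : s.OrdConnected)
    (hne : s.Nonempty) (hb : BddBelow s) (ha : BddAbove s) :
    s = Ioo (sInf s) (sSup s) := by
  refine Subset.antisymm (fun x hx => ?_)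
    (IsConnected.Ioo_csInf_csSup_subset ⟨hne, hc.isPreconnected⟩ hb ha)
  obtain ⟨ε, hε, hs⟩ := Metric.isOpen_iff.1 ho x hx
  rw [Real.ball_eq_Ioo] at hs
  have h1 := csInf_le hb (hs (⟨by linarith, by linarith⟩ : x - ε / 2 ∈ Ioo (x - ε) (x + ε)))
  have h2 := le_csSup ha (hs (⟨by linarith, by linarith⟩ : x + ε / 2 ∈ Ioo (x - ε) (x + ε)))
  exact ⟨by linarith, by linarith⟩

/-- The fundamental theorem of calculus along an interval cut out of an open set by a line `e`. -/
theorem exists_slice_integral_eq_sub {X : Type*} [TopologicalSpace X] {Ω : Set X} (ho : IsOpen Ω)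
    {e : ℝ → X} (he : Continuous e) (hc : (e ⁻¹' Ω).OrdConnected) (hne : (e ⁻¹' Ω).Nonempty)
    (hb : BddBelow (e ⁻¹' Ω)) (ha : BddAbove (e ⁻¹' Ω)) {f f' : X → ℝ}
    (hf : ContinuousOn f (closure Ω)) (hf' : ContinuousOn f' (closure Ω))
    (hd : ∀ x ∈ e ⁻¹' Ω, HasDerivAt (fun x => f (e x)) (f' (e x)) x) :
    ∃ l r, l < r ∧ e ⁻¹' Ω = Ioo l r ∧ e l ∈ frontier Ω ∧ e r ∈ frontier Ω ∧
      ∫ x in e ⁻¹' Ω, f' (e x) = f (e r) - f (e l) := by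
  have heq := eq_Ioo_of_isOpen_of_ordConnected (ho.preimage he) hc hne hb ha
  set l := sInf (e ⁻¹' Ω)
  set r := sSup (e ⁻¹' Ω)
  have hlr : l < r := by
    rw [heq] at hne
    exact nonempty_Ioo.1 hne
  have hcl : Icc l r ⊆ e ⁻¹' closure Ω := by
    rw [← closure_Ioo hlr.ne, ← heq]
    exact he.closure_preimage_subset Ω
  have hfr : ∀ x ∈ Icc l r, x ∉ Ioo l r → e x ∈ frontier Ω := fun x hx hx' => by
    rw [ho.frontier_eq]
    exact ⟨hcl hx, fun h => hx' (heq ▸ h)⟩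
  refine ⟨l, r, hlr, heq, hfr l ⟨le_rfl, hlr.le⟩ (by simp), hfr r ⟨hlr.le, le_rfl⟩ (by simp), ?_⟩
  rw [heq, ← integral_Ioc_eq_integral_Ioo, ← intervalIntegral.integral_of_le hlr.le]
  refine intervalIntegral.integral_eq_sub_of_hasDerivAt_of_le (f := fun x => f (e x))
    (f' := fun x => f' (e x)) hlr.le (hf.comp he.continuousOn hcl)
    (fun x hx => hd x (heq ▸ hx)) ?_
  apply ContinuousOn.intervalIntegrable
  rw [uIcc_of_le hlr.le]
  exact hf'.comp he.continuousOn hcl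

theorem integral_eq_integral_slice_fst {Ω : Set (ℝ × ℝ)} (hΩ : MeasurableSet Ω) {F : ℝ × ℝ → ℝ}
    (hF : IntegrableOn F Ω) :
    Integrable (fun y => ∫ x in (fun x => (x, y)) ⁻¹' Ω, F (x, y)) ∧
      ∫ z in Ω, F z = ∫ y, ∫ x in (fun x => (x, y)) ⁻¹' Ω, F (x, y) := by
  rw [← integrable_indicator_iff hΩ, Measure.volume_eq_prod] at hF
  have h : ∀ y, ∫ x in (fun x => (x, y)) ⁻¹' Ω, F (x, y) = ∫ x, Ω.indicator F (x, y) := fun y => by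
    rw [← integral_indicator (measurable_prodMk_right hΩ)]
    rfl
  simp_rw [h]
  refine ⟨hF.integral_prod_right, ?_⟩
  rw [← integral_indicator hΩ, Measure.volume_eq_prod, integral_prod_symm _ hF]

theorem integral_eq_integral_slice_snd {Ω : Set (ℝ × ℝ)} (hΩ : MeasurableSet Ω) {F : ℝ × ℝ → ℝ}
    (hF : IntegrableOn F Ω) :
    Integrable (fun x => ∫ y in (fun y => (x, y)) ⁻¹' Ω, F (x, y)) ∧
      ∫ z in Ω, F z = ∫ x, ∫ y in (fun y => (x, y)) ⁻¹' Ω, F (x, y) := by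
  rw [← integrable_indicator_iff hΩ, Measure.volume_eq_prod] at hF
  have h : ∀ x, ∫ y in (fun y => (x, y)) ⁻¹' Ω, F (x, y) = ∫ y, Ω.indicator F (x, y) := fun x => by
    rw [← integral_indicator (measurable_prodMk_left hΩ)]
    rfl
  simp_rw [h]
  refine ⟨hF.integral_prod_left, ?_⟩
  rw [← integral_indicator hΩ, Measure.volume_eq_prod, integral_prod _ hF]

end Slicing

/-! ### The sonic curve. -/

namespace IsSonic

variable {σ : ℝ → ℝ}

theorem strictMonoOn (hσ : IsSonic σ) : StrictMonoOn σ (Ici 0) := by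
  refine strictMonoOn_of_deriv_pos (convex_Ici 0) hσ.contDiff.continuous.continuousOn ?_
  simpa using hσ.deriv_pos

theorem nonneg (hσ : IsSonic σ) {y : ℝ} (hy : 0 ≤ y) : 0 ≤ σ y := by
  have := hσ.strictMonoOn.monotoneOn (mem_Ici.2 le_rfl) (mem_Ici.2 hy) hy
  rwa [hσ.zero] at this

theorem hasDerivAt (hσ : IsSonic σ) (y : ℝ) : HasDerivAt σ (deriv σ y) y :=
  (hσ.contDiff.differentiable one_ne_zero y).hasDerivAt

theorem continuous_deriv (hσ : IsSonic σ) : Continuous (deriv σ) :=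
  hσ.contDiff.continuous_deriv le_rfl

end IsSonic

/-! ### Geometry of the arcs and of the enclosed region. -/

namespace Arcs

/-- The function `g`, extended to the line by its values at the endpoints. -/
noncomputable def gExt (D : Arcs) (x : ℝ) : ℝ := D.g (max 0 (min D.x₀ x))

/-- The function `γ`, extended to the line by its values at the endpoints. -/
noncomputable def γExt (D : Arcs) (y : ℝ) : ℝ := D.γ (max D.y₀ (min D.y₁ y))

theorem gExt_of_mem {D : Arcs} {x : ℝ} (hx : x ∈ Icc 0 D.x₀) : D.gExt x = D.g x := by
  rw [gExt, min_eq_right hx.2, max_eq_right hx.1]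

theorem γExt_of_mem {D : Arcs} {y : ℝ} (hy : y ∈ Icc D.y₀ D.y₁) : D.γExt y = D.γ y := by
  rw [γExt, min_eq_right hy.2, max_eq_right hy.1]

namespace Admissible

variable {D : Arcs} {σ a b : ℝ → ℝ} {p q ℓ δ : ℝ}

theorem g_strictMonoOn (hD : D.Admissible σ a b p q ℓ δ) : StrictMonoOn D.g (Icc 0 D.x₀) := by
  refine strictMonoOn_of_deriv_pos (convex_Icc _ _) hD.g_cont ?_
  rw [interior_Icc]
  exact hD.g_deriv

theorem y₀_pos (hD : D.Admissible σ a b p q ℓ δ) : 0 < D.y₀ := by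
  have := hD.g_strictMonoOn (left_mem_Icc.2 hD.x₀_pos.le) (right_mem_Icc.2 hD.x₀_pos.le) hD.x₀_pos
  rwa [hD.g_zero, hD.g_end] at this

theorem g_hasDerivAt (hD : D.Admissible σ a b p q ℓ δ) {x : ℝ} (hx : x ∈ Ioo 0 D.x₀) :
    HasDerivAt D.g (deriv D.g x) x :=
  ((hD.g_smooth.differentiableOn one_ne_zero x hx).differentiableAt
    (isOpen_Ioo.mem_nhds hx)).hasDerivAt

theorem g_image (hD : D.Admissible σ a b p q ℓ δ) : D.g '' Ioo 0 D.x₀ = Ioo 0 D.y₀ := by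
  refine Subset.antisymm ?_ ?_
  · rintro _ ⟨x, hx, rfl⟩
    have h1 := hD.g_strictMonoOn (left_mem_Icc.2 hD.x₀_pos.le) (Ioo_subset_Icc_self hx) hx.1
    have h2 := hD.g_strictMonoOn (Ioo_subset_Icc_self hx) (right_mem_Icc.2 hD.x₀_pos.le) hx.2
    rw [hD.g_zero] at h1
    rw [hD.g_end] at h2
    exact ⟨h1, h2⟩
  · have := intermediate_value_Ioo hD.x₀_pos.le hD.g_cont
    rwa [hD.g_zero, hD.g_end] at this

theorem γ_antitoneOn (hD : D.Admissible σ a b p q ℓ δ) : AntitoneOn D.γ (Icc D.y₀ D.y₁) := by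
  refine antitoneOn_of_deriv_nonpos (convex_Icc _ _) hD.γ_cont ?_ ?_ <;> rw [interior_Icc]
  · exact fun y hy => (hD.γ_char y hy).differentiableAt.differentiableWithinAt
  · intro y hy
    rw [(hD.γ_char y hy).deriv]
    exact neg_nonpos.2 (Real.sqrt_nonneg _)

theorem γ_le (hD : D.Admissible σ a b p q ℓ δ) {y : ℝ} (hy : y ∈ Icc D.y₀ D.y₁) :
    D.γ y ≤ D.x₀ :=
  hD.γ_start ▸ hD.γ_antitoneOn (left_mem_Icc.2 hD.y₀_lt_y₁.le) hy hy.1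

/-- Starting from the sonic curve, `γ` does not increase while `σ` strictly increases. The
strictness makes `γ` injective, as the change of variables along `Γ` requires. -/
theorem γ_lt_sonic (hσ : IsSonic σ) (hD : D.Admissible σ a b p q ℓ δ) {y : ℝ}
    (hy : y ∈ Ioo D.y₀ D.y₁) : D.γ y < σ y := by
  refine (hD.γ_le (Ioo_subset_Icc_self hy)).trans_lt ?_
  rw [← hD.sonic_end]
  exact hσ.strictMonoOn hD.y₀_pos.le (hD.y₀_pos.trans hy.1).le hy.1

theorem γ_strictAntiOn (hσ : IsSonic σ) (hD : D.Admissible σ a b p q ℓ δ) :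
    StrictAntiOn D.γ (Icc D.y₀ D.y₁) := by
  refine strictAntiOn_of_deriv_neg (convex_Icc _ _) hD.γ_cont ?_
  rw [interior_Icc]
  intro y hy
  rw [(hD.γ_char y hy).deriv]
  exact neg_neg_of_pos (Real.sqrt_pos.2 (sub_pos.2 (hD.γ_lt_sonic hσ hy)))

theorem γ_image (hσ : IsSonic σ) (hD : D.Admissible σ a b p q ℓ δ) :
    D.γ '' Ioo D.y₀ D.y₁ = Ioo (D.γ D.y₁) D.x₀ := by
  have hl := left_mem_Icc.2 hD.y₀_lt_y₁.le
  have hr := right_mem_Icc.2 hD.y₀_lt_y₁.le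
  refine Subset.antisymm ?_ ?_
  · rintro _ ⟨y, hy, rfl⟩
    have h1 := hD.γ_strictAntiOn hσ hl (Ioo_subset_Icc_self hy) hy.1
    rw [hD.γ_start] at h1
    exact ⟨hD.γ_strictAntiOn hσ (Ioo_subset_Icc_self hy) hr hy.2, h1⟩
  · have := intermediate_value_Ioo' hD.y₀_lt_y₁.le hD.γ_cont
    rwa [hD.γ_start] at this

theorem gExt_continuous (hD : D.Admissible σ a b p q ℓ δ) : Continuous D.gExt :=
  hD.g_cont.comp_continuous (by fun_prop)
    fun x => ⟨le_max_left _ _, max_le hD.x₀_pos.le (min_le_left _ _)⟩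

theorem γExt_continuous (hD : D.Admissible σ a b p q ℓ δ) : Continuous D.γExt :=
  hD.γ_cont.comp_continuous (by fun_prop)
    fun x => ⟨le_max_left _ _, max_le hD.y₀_lt_y₁.le (min_le_left _ _)⟩

theorem gExt_monotone (hD : D.Admissible σ a b p q ℓ δ) : Monotone D.gExt := fun _ _ h =>
  hD.g_strictMonoOn.monotoneOn ⟨le_max_left _ _, max_le hD.x₀_pos.le (min_le_left _ _)⟩
    ⟨le_max_left _ _, max_le hD.x₀_pos.le (min_le_left _ _)⟩
    (max_le_max le_rfl (min_le_min le_rfl h))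

theorem γExt_antitone (hD : D.Admissible σ a b p q ℓ δ) : Antitone D.γExt := fun _ _ h =>
  hD.γ_antitoneOn ⟨le_max_left _ _, max_le hD.y₀_lt_y₁.le (min_le_left _ _)⟩
    ⟨le_max_left _ _, max_le hD.y₀_lt_y₁.le (min_le_left _ _)⟩
    (max_le_max le_rfl (min_le_min le_rfl h))

theorem gExt_of_nonpos (hD : D.Admissible σ a b p q ℓ δ) {x : ℝ} (hx : x ≤ 0) :
    D.gExt x = 0 := by
  rw [gExt, min_eq_right (hx.trans hD.x₀_pos.le), max_eq_left hx, hD.g_zero]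

theorem gExt_le (hD : D.Admissible σ a b p q ℓ δ) (x : ℝ) : D.gExt x ≤ D.y₀ := by
  have := hD.g_strictMonoOn.monotoneOn
    ⟨le_max_left _ _, max_le hD.x₀_pos.le (min_le_left _ _)⟩ (right_mem_Icc.2 hD.x₀_pos.le)
    (max_le hD.x₀_pos.le (min_le_left D.x₀ x))
  rwa [hD.g_end] at this

theorem γExt_of_le (hD : D.Admissible σ a b p q ℓ δ) {y : ℝ} (hy : y ≤ D.y₀) :
    D.γExt y = D.x₀ := by
  rw [γExt, min_eq_right (hy.trans hD.y₀_lt_y₁.le), max_eq_left hy, hD.γ_start]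

theorem γExt_le (hD : D.Admissible σ a b p q ℓ δ) (y : ℝ) : D.γExt y ≤ D.x₀ :=
  hD.γ_le ⟨le_max_left _ _, max_le hD.y₀_lt_y₁.le (min_le_left _ _)⟩

theorem c_bounds (hD : D.Admissible σ a b p q ℓ δ) {t : ℝ} (ht : t ∈ Icc (0 : ℝ) 1) :
    D.γ D.y₁ ≤ (D.c t).1 ∧ (D.c t).1 ≤ 0 ∧ 0 ≤ (D.c t).2 ∧ (D.c t).2 ≤ D.y₁ := by
  have h0 : (0 : ℝ) ∈ Icc (0 : ℝ) 1 := by simp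
  have h1 : (1 : ℝ) ∈ Icc (0 : ℝ) 1 := by simp
  have a1 := hD.c_fst h0 ht ht.1
  have a2 := hD.c_fst ht h1 ht.2
  have a3 := hD.c_snd h0 ht ht.1
  have a4 := hD.c_snd ht h1 ht.2
  simp only [hD.c_start, hD.c_end] at a1 a2 a3 a4
  exact ⟨a1, a2, a4, a3⟩

/-- With the constant extensions the case distinctions disappear: `gExt = 0` for `x ≤ 0` encodes `y
> 0`, and `γExt = x₀` for `y ≤ y₀` encodes `x < x₀`. Openness and the shape of the slices can then
be read off from continuity and monotonicity. -/
theorem mem_region_iff (hD : D.Admissible σ a b p q ℓ δ) {z : ℝ × ℝ} :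
    z ∈ D.region ↔ (∃ t ∈ Icc (0 : ℝ) 1, (D.c t).1 < z.1 ∧ (D.c t).2 < z.2) ∧
      D.gExt z.1 < z.2 ∧ z.2 < D.y₁ ∧ z.1 < D.γExt z.2 := by
  refine and_congr_right fun ⟨t, ht, _, ht2⟩ => ?_
  have hz : 0 < z.2 := (hD.c_bounds ht).2.2.1.trans_lt ht2
  constructor
  · rintro ⟨h1, h2, h3⟩
    refine ⟨?_, h2, ?_⟩
    · rcases le_or_gt z.1 0 with h | h
      · rwa [hD.gExt_of_nonpos h]
      · rw [gExt_of_mem ⟨h.le, (h1 h).1.le⟩]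
        exact (h1 h).2
    · rcases le_or_gt D.y₀ z.2 with h | h
      · rw [γExt_of_mem ⟨h, h2.le⟩]
        exact h3 h
      · rw [hD.γExt_of_le h.le]
        rcases le_or_gt z.1 0 with h | h
        · exact h.trans_lt hD.x₀_pos
        · exact (h1 h).1
  · rintro ⟨h1, h2, h3⟩
    have hx := h3.trans_le (hD.γExt_le _)
    refine ⟨fun h => ⟨hx, ?_⟩, h2, fun h => ?_⟩
    · rwa [gExt_of_mem ⟨h.le, hx.le⟩] at h1
    · rwa [γExt_of_mem ⟨h, h2.le⟩] at h3

theorem isOpen_region (hD : D.Admissible σ a b p q ℓ δ) : IsOpen D.region := by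
  have : D.region = {z | ∃ t ∈ Icc (0 : ℝ) 1, (D.c t).1 < z.1 ∧ (D.c t).2 < z.2} ∩
      ({z | D.gExt z.1 < z.2} ∩ ({z | z.2 < D.y₁} ∩ {z | z.1 < D.γExt z.2})) := by
    ext z
    exact hD.mem_region_iff
  rw [this]
  refine IsOpen.inter ?_ (IsOpen.inter ?_ (IsOpen.inter ?_ ?_))
  · have : {z : ℝ × ℝ | ∃ t ∈ Icc (0 : ℝ) 1, (D.c t).1 < z.1 ∧ (D.c t).2 < z.2} =
        ⋃ t ∈ Icc (0 : ℝ) 1, Ioi (D.c t).1 ×ˢ Ioi (D.c t).2 := by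
      ext z
      simp only [mem_ofPred_eq, mem_iUnion, exists_prop, mem_prod, mem_Ioi]
    rw [this]
    exact isOpen_biUnion fun t _ => isOpen_Ioi.prod isOpen_Ioi
  · exact isOpen_lt (hD.gExt_continuous.comp continuous_fst) continuous_snd
  · exact isOpen_lt continuous_snd continuous_const
  · exact isOpen_lt continuous_fst (hD.γExt_continuous.comp continuous_snd)

theorem snd_pos (hD : D.Admissible σ a b p q ℓ δ) {z : ℝ × ℝ} (hz : z ∈ D.region) :
    0 < z.2 := by
  obtain ⟨t, ht, _, h⟩ := hz.1
  exact (hD.c_bounds ht).2.2.1.trans_lt h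

theorem fst_mem (hD : D.Admissible σ a b p q ℓ δ) {z : ℝ × ℝ} (hz : z ∈ D.region) :
    z.1 ∈ Ioo (D.γ D.y₁) D.x₀ := by
  obtain ⟨⟨t, ht, h, _⟩, _, _, h'⟩ := hD.mem_region_iff.1 hz
  exact ⟨(hD.c_bounds ht).1.trans_lt h, h'.trans_le (hD.γExt_le _)⟩

/-- By monotonicity of the extended arcs, each defining inequality is inherited by a point between
`x` and `x'` from one of these two. -/
theorem ordConnected_slice_fst (hD : D.Admissible σ a b p q ℓ δ) (y : ℝ) :
    ((fun x => (x, y)) ⁻¹' D.region).OrdConnected := by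
  refine ordConnected_def.2 fun x hx x' hx' u hu => ?_
  rw [mem_preimage, hD.mem_region_iff] at *
  obtain ⟨⟨t, ht, h1, h2⟩, h3, h4, h5⟩ := hx
  exact ⟨⟨t, ht, h1.trans_le hu.1, h2⟩, (hD.gExt_monotone hu.2).trans_lt hx'.2.1, h4,
    hu.2.trans_lt hx'.2.2.2⟩

theorem ordConnected_slice_snd (hD : D.Admissible σ a b p q ℓ δ) (x : ℝ) :
    ((fun y => (x, y)) ⁻¹' D.region).OrdConnected := by
  refine ordConnected_def.2 fun y hy y' hy' u hu => ?_
  rw [mem_preimage, hD.mem_region_iff] at *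
  obtain ⟨⟨t, ht, h1, h2⟩, h3, h4, h5⟩ := hy
  exact ⟨⟨t, ht, h1, h2.trans_le hu.1⟩, h3.trans_le hu.1, hu.2.trans_lt hy'.2.2.1,
    hy'.2.2.2.trans_le (hD.γExt_antitone hu.2)⟩

/-- Every point of `Γ` between its endpoints lies above and to the right of a point of `C₂`. -/
theorem exists_C₂_lt_Γ (hD : D.Admissible σ a b p q ℓ δ) {y : ℝ}
    (hy : y ∈ Ioo D.y₀ D.y₁) : ∃ t ∈ Icc (0 : ℝ) 1, (D.c t).1 < D.γ y ∧ (D.c t).2 < y := by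
  -- Otherwise `C₂`, which ends at the origin to the left of `γExt`, would cross the graph of `γExt`
  -- below height `y₁`. At height at least `y₀` this is a forbidden point of `C₂ ∩ Γ`; lower down
  -- `γExt = x₀ > 0`, whereas `C₂` lies in `x ≤ 0`.
  have key : ∀ t ∈ Icc (0 : ℝ) 1, (D.c t).2 < D.y₁ → (D.c t).1 < D.γExt (D.c t).2 := by
    intro t ht hty
    by_contra! hle
    let h : ℝ → ℝ := fun s => D.γExt (D.c s).2 - (D.c s).1
    have hsub : Icc t 1 ⊆ Icc (0 : ℝ) 1 := Icc_subset_Icc_left ht.1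
    have hcont : ContinuousOn h (Icc t 1) := by
      have hc := hD.c_cont.mono hsub
      exact (hD.γExt_continuous.comp_continuousOn hc.snd).sub hc.fst
    have h1 : 0 ≤ h 1 := by
      simp only [h, hD.c_end, hD.γExt_of_le hD.y₀_pos.le, sub_zero]
      exact hD.x₀_pos.le
    obtain ⟨s, hs, hs0⟩ := intermediate_value_Icc ht.2 hcont
      (⟨sub_nonpos.2 hle, h1⟩ : (0 : ℝ) ∈ Icc (h t) (h 1))
    have hs0' : D.γExt (D.c s).2 = (D.c s).1 := sub_eq_zero.1 hs0
    have hs2 : (D.c s).2 ≤ (D.c t).2 := hD.c_snd ht (hsub hs) hs.1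
    rcases le_or_gt D.y₀ (D.c s).2 with h' | h'
    · have hm : (D.c s).2 ∈ Icc D.y₀ D.y₁ := ⟨h', hs2.trans hty.le⟩
      rw [γExt_of_mem hm] at hs0'
      have : D.c s ∈ D.C₂ ∩ D.Γ := ⟨⟨s, hsub hs, rfl⟩, ⟨_, hm, Prod.ext hs0' rfl⟩⟩
      rw [hD.C₂_inter_Γ, mem_singleton_iff] at this
      rw [this] at hs2
      exact absurd hs2 (not_le.2 hty)
    · rw [hD.γExt_of_le h'.le] at hs0'
      have := (hD.c_bounds (hsub hs)).2.1
      linarith [hD.x₀_pos]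
  have hcy : ContinuousOn (fun t => (D.c t).2) (Icc (0 : ℝ) 1) := hD.c_cont.snd
  have hym : y ∈ Ioo (D.c 1).2 (D.c 0).2 := by
    rw [hD.c_start, hD.c_end]
    exact ⟨hD.y₀_pos.trans hy.1, hy.2⟩
  obtain ⟨t, ht, hty⟩ := intermediate_value_Ioo' zero_le_one hcy hym
  have ht' := Ioo_subset_Icc_self ht
  have hlt : (D.c t).1 < D.γ y := by
    have := key t ht' (lt_of_eq_of_lt hty hy.2)
    simp only at hty
    rwa [hty, γExt_of_mem (Ioo_subset_Icc_self hy)] at this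
  -- `C₂` may run horizontally at height `y`, so the time `t` itself need not serve. Just after the
  -- last time with height at least `y`, the height is below `y` and, by continuity, the abscissa is
  -- still less than `γ y`.
  have hcl : IsClosed {s | s ∈ Icc (0 : ℝ) 1 ∧ y ≤ (D.c s).2} :=
    hcy.preimage_isClosed_of_isClosed isClosed_Icc isClosed_Ici
  set S := {s | s ∈ Icc (0 : ℝ) 1 ∧ y ≤ (D.c s).2}
  have hne : S.Nonempty := ⟨t, ht', hty.ge⟩
  have hbd : BddAbove S := ⟨1, fun s hs => hs.1.2⟩
  obtain ⟨hm1, hm2⟩ : sSup S ∈ S := hcl.csSup_mem hne hbd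
  set m := sSup S
  have hmy : (D.c m).2 ≤ y := hty ▸ hD.c_snd ht' hm1 (le_csSup hbd ⟨ht', hty.ge⟩)
  have hmx : (D.c m).1 < D.γ y := by
    have := key m hm1 (hmy.trans_lt hy.2)
    rwa [le_antisymm hmy hm2, γExt_of_mem (Ioo_subset_Icc_self hy)] at this
  have hm_lt : m < 1 := by
    refine lt_of_le_of_ne hm1.2 fun h => ?_
    rw [h, hD.c_end] at hm2
    exact absurd hm2 (not_le.2 (hD.y₀_pos.trans hy.1))
  have hev : ∀ᶠ s in nhdsWithin m (Icc 0 1), (D.c s).1 < D.γ y :=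
    (hD.c_cont.fst m hm1).eventually (isOpen_Iio.mem_nhds hmx)
  have hev' : ∀ᶠ s in nhdsWithin m (Ioo m 1), (D.c s).1 < D.γ y :=
    hev.filter_mono (nhdsWithin_mono _ (Ioo_subset_Icc_self.trans (Icc_subset_Icc_left hm1.1)))
  have : (nhdsWithin m (Ioo m 1)).NeBot := by
    rw [← mem_closure_iff_nhdsWithin_neBot, closure_Ioo hm_lt.ne]
    exact left_mem_Icc.2 hm_lt.le
  obtain ⟨s, hs1, hs2⟩ := (hev'.and self_mem_nhdsWithin).exists
  have hsm : s ∈ Icc (0 : ℝ) 1 := ⟨hm1.1.trans hs2.1.le, hs2.2.le⟩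
  refine ⟨s, hsm, hs1, ?_⟩
  by_contra! hle
  exact absurd (le_csSup hbd ⟨hsm, hle⟩) (not_le.2 hs2.1)

end Admissible
end Arcs
end ColdPlasma

/-! ### Endpoints of the slices and Green's formula. -/

namespace ColdPlasma
namespace Arcs
namespace Admissible

variable {D : Arcs} {σ a b : ℝ → ℝ} {p q ℓ δ : ℝ}

theorem isBounded_region (hD : D.Admissible σ a b p q ℓ δ) : Bornology.IsBounded D.region :=
  ((Metric.isBounded_Icc p ℓ).prod (Metric.isBounded_Icc 0 q)).subset
    (hD.subset_rectangle.trans (prod_mono Ico_subset_Icc_self subset_rfl))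

theorem isCompact_closure_region (hD : D.Admissible σ a b p q ℓ δ) :
    IsCompact (closure D.region) :=
  hD.isBounded_region.isCompact_closure

theorem integrableOn_region (hD : D.Admissible σ a b p q ℓ δ) {f : ℝ × ℝ → ℝ}
    (hf : ContinuousOn f (closure D.region)) : IntegrableOn f D.region :=
  (hf.integrableOn_compact hD.isCompact_closure_region).mono_set subset_closure

theorem exists_slice_fst (hD : D.Admissible σ a b p q ℓ δ) {y : ℝ}
    (hne : ((fun x => (x, y)) ⁻¹' D.region).Nonempty) {U Ux : ℝ × ℝ → ℝ}
    (hU : ContinuousOn U (closure D.region)) (hUx : ContinuousOn Ux (closure D.region))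
    (hd : ∀ z ∈ D.region, HasDerivAt (fun x => U (x, z.2)) (Ux z) z.1) :
    ∃ l r, l < r ∧ (fun x => (x, y)) ⁻¹' D.region = Ioo l r ∧
      (l, y) ∈ frontier D.region \ D.Γ ∧ (r, y) ∈ frontier D.region ∧
      ∫ x in (fun x => (x, y)) ⁻¹' D.region, Ux (x, y) = U (r, y) - U (l, y) := by
  obtain ⟨l, r, hlr, heq, hl, hr, hi⟩ := exists_slice_integral_eq_sub hD.isOpen_region
    (e := fun x => (x, y)) (by fun_prop) (hD.ordConnected_slice_fst y) hne
    ⟨p, fun x hx => (hD.subset_rectangle hx).1.1⟩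
    ⟨ℓ, fun x hx => (hD.subset_rectangle hx).1.2.le⟩ hU hUx (fun x hx => hd (x, y) hx)
  refine ⟨l, r, hlr, heq, ⟨hl, ?_⟩, hr, hi⟩
  -- A left endpoint on `Γ` would be `γ y'`, but every point of the slice lies to the left of `γ
  -- y'`.
  rintro ⟨y', hy', h⟩
  obtain ⟨h1, rfl⟩ := Prod.mk.inj h
  obtain ⟨x, hx⟩ := nonempty_Ioo.2 hlr
  have hm : x ∈ (fun x => (x, y')) ⁻¹' D.region := heq ▸ hx
  have := (hD.mem_region_iff.1 hm).2.2.2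
  rw [γExt_of_mem hy', h1] at this
  exact lt_asymm hx.1 this

theorem exists_slice_snd (hD : D.Admissible σ a b p q ℓ δ) {x : ℝ}
    (hne : ((fun y => (x, y)) ⁻¹' D.region).Nonempty) {V Vy : ℝ × ℝ → ℝ}
    (hV : ContinuousOn V (closure D.region)) (hVy : ContinuousOn Vy (closure D.region))
    (hd : ∀ z ∈ D.region, HasDerivAt (fun y => V (z.1, y)) (Vy z) z.2) :
    ∃ l r, l < r ∧ (fun y => (x, y)) ⁻¹' D.region = Ioo l r ∧
      (x, l) ∈ frontier D.region \ D.Γ ∧ (x, r) ∈ frontier D.region ∧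
      ∫ y in (fun y => (x, y)) ⁻¹' D.region, Vy (x, y) = V (x, r) - V (x, l) := by
  obtain ⟨l, r, hlr, heq, hl, hr, hi⟩ := exists_slice_integral_eq_sub hD.isOpen_region
    (e := fun y => (x, y)) (by fun_prop) (hD.ordConnected_slice_snd x) hne
    ⟨0, fun y hy => (hD.subset_rectangle hy).2.1⟩
    ⟨q, fun y hy => (hD.subset_rectangle hy).2.2⟩ hV hVy (fun y hy => hd (x, y) hy)
  refine ⟨l, r, hlr, heq, ⟨hl, ?_⟩, hr, hi⟩
  rintro ⟨y', hy', h⟩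
  obtain ⟨rfl, rfl⟩ := Prod.mk.inj h
  obtain ⟨y, hy⟩ := nonempty_Ioo.2 hlr
  have hm : y ∈ (fun y => (D.γ y', y)) ⁻¹' D.region := heq ▸ hy
  have h1 := (hD.mem_region_iff.1 hm).2.2.2
  have h2 := hD.γExt_antitone hy.1.le
  rw [γExt_of_mem hy'] at h2
  exact absurd h1 (not_lt.2 h2)

theorem slice_fst_eq_empty (hD : D.Admissible σ a b p q ℓ δ) {y : ℝ} (hy : y ∉ Ioo 0 D.y₁) :
    (fun x => (x, y)) ⁻¹' D.region = ∅ :=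
  eq_empty_of_forall_notMem fun _ hx => hy ⟨hD.snd_pos hx, (hD.mem_region_iff.1 hx).2.2.1⟩

theorem slice_snd_eq_empty (hD : D.Admissible σ a b p q ℓ δ) {x : ℝ}
    (hx : x ∉ Ioo (D.γ D.y₁) D.x₀) : (fun y => (x, y)) ⁻¹' D.region = ∅ :=
  eq_empty_of_forall_notMem fun _ hy => hx (hD.fst_mem hy)

/-- The horizontal slice through a point of `Γ` ends at that point. -/
theorem isLUB_slice_fst_Γ (hD : D.Admissible σ a b p q ℓ δ) {y : ℝ} (hy : y ∈ Ioo D.y₀ D.y₁) :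
    ((fun x => (x, y)) ⁻¹' D.region).Nonempty ∧
      IsLUB ((fun x => (x, y)) ⁻¹' D.region) (D.γ y) := by
  obtain ⟨t, ht, h1, h2⟩ := hD.exists_C₂_lt_Γ hy
  have hγ := γExt_of_mem (Ioo_subset_Icc_self hy)
  have hsub : Ioo (D.c t).1 (D.γ y) ⊆ (fun x => (x, y)) ⁻¹' D.region := fun x hx =>
    hD.mem_region_iff.2 ⟨⟨t, ht, hx.1, h2⟩, (hD.gExt_le x).trans_lt hy.1, hy.2, hγ.symm ▸ hx.2⟩
  refine ⟨(nonempty_Ioo.2 h1).mono hsub, fun x hx => ?_, fun u hu => ?_⟩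
  · have := (hD.mem_region_iff.1 hx).2.2.2
    exact hγ ▸ this.le
  · exact (isLUB_Ioo h1).2 (upperBounds_mono_set hsub hu)

/-- The horizontal slice through a point of `C₁` ends at that point. -/
theorem isLUB_slice_fst_C₁ (hD : D.Admissible σ a b p q ℓ δ) {x : ℝ} (hx : x ∈ Ioo 0 D.x₀) :
    ((fun u => (u, D.g x)) ⁻¹' D.region).Nonempty ∧
      IsLUB ((fun u => (u, D.g x)) ⁻¹' D.region) x := by
  have hy : D.g x ∈ Ioo 0 D.y₀ := hD.g_image ▸ mem_image_of_mem D.g hx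
  have hsub : Ioo 0 x ⊆ (fun u => (u, D.g x)) ⁻¹' D.region := fun u hu => by
    have hu' : u ∈ Icc 0 D.x₀ := ⟨hu.1.le, (hu.2.trans hx.2).le⟩
    refine hD.mem_region_iff.2 ⟨⟨1, by simp, ?_, ?_⟩, ?_, hy.2.trans hD.y₀_lt_y₁, ?_⟩
    · simpa only [hD.c_end] using hu.1
    · simpa only [hD.c_end] using hy.1
    · rw [gExt_of_mem hu']
      exact hD.g_strictMonoOn hu' (Ioo_subset_Icc_self hx) hu.2
    · rw [hD.γExt_of_le hy.2.le]
      exact hu.2.trans hx.2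
  refine ⟨(nonempty_Ioo.2 hx.1).mono hsub, fun u hu => ?_, fun u hu => ?_⟩
  · by_contra! h
    have h1 := (hD.mem_region_iff.1 hu).2.1
    have h2 := hD.gExt_monotone h.le
    rw [gExt_of_mem (Ioo_subset_Icc_self hx)] at h2
    exact absurd h1 (not_lt.2 h2)
  · exact (isLUB_Ioo hx.1).2 (upperBounds_mono_set hsub hu)

/-- The vertical slice through a point of `Γ` ends at that point. -/
theorem isLUB_slice_snd_Γ (hσ : IsSonic σ) (hD : D.Admissible σ a b p q ℓ δ) {y : ℝ}
    (hy : y ∈ Ioo D.y₀ D.y₁) :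
    ((fun u => (D.γ y, u)) ⁻¹' D.region).Nonempty ∧
      IsLUB ((fun u => (D.γ y, u)) ⁻¹' D.region) y := by
  obtain ⟨t, ht, h1, h2⟩ := hD.exists_C₂_lt_Γ hy
  have hmax : max (D.c t).2 D.y₀ < y := max_lt h2 hy.1
  have hsub : Ioo (max (D.c t).2 D.y₀) y ⊆ (fun u => (D.γ y, u)) ⁻¹' D.region := fun u hu => by
    have hu1 := (le_max_left _ _).trans_lt hu.1
    have hu2 := (le_max_right _ _).trans_lt hu.1
    have hu' : u ∈ Icc D.y₀ D.y₁ := ⟨hu2.le, (hu.2.trans hy.2).le⟩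
    refine hD.mem_region_iff.2 ⟨⟨t, ht, h1, hu1⟩, (hD.gExt_le _).trans_lt hu2, hu.2.trans hy.2, ?_⟩
    rw [γExt_of_mem hu']
    exact hD.γ_strictAntiOn hσ hu' (Ioo_subset_Icc_self hy) hu.2
  refine ⟨(nonempty_Ioo.2 hmax).mono hsub, fun u hu => ?_, fun u hu => ?_⟩
  · by_contra! h
    have h1 := (hD.mem_region_iff.1 hu).2.2.2
    have h2 := hD.γExt_antitone h.le
    rw [γExt_of_mem (Ioo_subset_Icc_self hy)] at h2
    exact absurd h1 (not_lt.2 h2)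
  · exact (isLUB_Ioo hmax).2 (upperBounds_mono_set hsub hu)

/-- The vertical slice through a point of `C₁` starts at that point. -/
theorem isGLB_slice_snd_C₁ (hD : D.Admissible σ a b p q ℓ δ) {x : ℝ} (hx : x ∈ Ioo 0 D.x₀) :
    IsGLB ((fun u => (x, u)) ⁻¹' D.region) (D.g x) := by
  have hy : D.g x ∈ Ioo 0 D.y₀ := hD.g_image ▸ mem_image_of_mem D.g hx
  have hsub : Ioo (D.g x) D.y₀ ⊆ (fun u => (x, u)) ⁻¹' D.region := fun u hu => by
    refine hD.mem_region_iff.2 ⟨⟨1, by simp, ?_, ?_⟩, ?_, hu.2.trans hD.y₀_lt_y₁, ?_⟩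
    · simpa only [hD.c_end] using hx.1
    · simpa only [hD.c_end] using hy.1.trans hu.1
    · rw [gExt_of_mem (Ioo_subset_Icc_self hx)]
      exact hu.1
    · rw [hD.γExt_of_le hu.2.le]
      exact hx.2
  refine ⟨fun u hu => ?_, fun u hu => ?_⟩
  · have := (hD.mem_region_iff.1 hu).2.1
    rw [gExt_of_mem (Ioo_subset_Icc_self hx)] at this
    exact this.le
  · exact (isGLB_Ioo hy.2).2 (lowerBounds_mono_set hsub hu)

/-- Green's formula for `(U, V)` on the region, as an inequality: the flux through the boundary is
nonnegative as soon as it is so, in the appropriate sense, through each of the arcs. -/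
theorem integral_divergence_nonneg (hσ : IsSonic σ) (hD : D.Admissible σ a b p q ℓ δ)
    {U V Ux Vy : ℝ × ℝ → ℝ}
    (hU : ContinuousOn U (closure D.region)) (hUx : ContinuousOn Ux (closure D.region))
    (hV : ContinuousOn V (closure D.region)) (hVy : ContinuousOn Vy (closure D.region))
    (hUd : ∀ z ∈ D.region, HasDerivAt (fun x => U (x, z.2)) (Ux z) z.1)
    (hVd : ∀ z ∈ D.region, HasDerivAt (fun y => V (z.1, y)) (Vy z) z.2)
    (hU_off : ∀ z ∈ frontier D.region \ D.Γ, U z ≤ 0)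
    (hV_off : ∀ z ∈ frontier D.region \ D.Γ, V z ≤ 0)
    (hC₁ : ∀ x ∈ Ioo 0 D.x₀, (x, D.g x) ∈ frontier D.region \ D.Γ →
      0 ≤ U (x, D.g x) * deriv D.g x - V (x, D.g x))
    (hΓ : ∀ y ∈ Ioo D.y₀ D.y₁, 0 ≤ U (D.γ y, y) + √(σ y - D.γ y) * V (D.γ y, y)) :
    0 ≤ ∫ z in D.region, (Ux z + Vy z) := by
  have hmeas := hD.isOpen_region.measurableSet
  rw [integral_add (hD.integrableOn_region hUx) (hD.integrableOn_region hVy)]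
  obtain ⟨hi1, he1⟩ := integral_eq_integral_slice_fst hmeas (hD.integrableOn_region hUx)
  obtain ⟨hi2, he2⟩ := integral_eq_integral_slice_snd hmeas (hD.integrableOn_region hVy)
  set F : ℝ → ℝ := fun y => ∫ x in (fun x => (x, y)) ⁻¹' D.region, Ux (x, y)
  set G : ℝ → ℝ := fun x => ∫ y in (fun y => (x, y)) ⁻¹' D.region, Vy (x, y)
  have hFΓ : ∀ y ∈ Ioo D.y₀ D.y₁, (D.γ y, y) ∈ closure D.region ∧ U (D.γ y, y) ≤ F y := by
    intro y hy
    obtain ⟨hne, hlub⟩ := hD.isLUB_slice_fst_Γ hy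
    obtain ⟨l, r, hlr, heq, hl, hr, hi⟩ := hD.exists_slice_fst hne hU hUx hUd
    have : r = D.γ y := (heq ▸ isLUB_Ioo hlr : IsLUB _ r).unique hlub
    subst this
    refine ⟨frontier_subset_closure hr, ?_⟩
    simp only [F, hi]
    linarith [hU_off _ hl]
  have hFC : ∀ x ∈ Ioo 0 D.x₀, (x, D.g x) ∈ frontier D.region \ D.Γ ∧
      U (x, D.g x) ≤ F (D.g x) := by
    intro x hx
    obtain ⟨hne, hlub⟩ := hD.isLUB_slice_fst_C₁ hx
    obtain ⟨l, r, hlr, heq, hl, hr, hi⟩ := hD.exists_slice_fst hne hU hUx hUd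
    have : r = x := (heq ▸ isLUB_Ioo hlr : IsLUB _ r).unique hlub
    subst this
    have hy : D.g r ∈ Ioo 0 D.y₀ := hD.g_image ▸ mem_image_of_mem D.g hx
    refine ⟨⟨hr, ?_⟩, ?_⟩
    · rintro ⟨y', hy', h⟩
      have h2 : y' = D.g r := (Prod.mk.inj h).2
      exact absurd hy'.1 (not_le.2 (h2 ▸ hy.2))
    · simp only [F, hi]
      linarith [hU_off _ hl]
  have hGΓ : ∀ y ∈ Ioo D.y₀ D.y₁, V (D.γ y, y) ≤ G (D.γ y) ∧
      (0 < D.γ y → G (D.γ y) = V (D.γ y, y) - V (D.γ y, D.g (D.γ y))) := by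
    intro y hy
    obtain ⟨hne, hlub⟩ := hD.isLUB_slice_snd_Γ hσ hy
    obtain ⟨l, r, hlr, heq, hl, hr, hi⟩ := hD.exists_slice_snd hne hV hVy hVd
    have : r = y := (heq ▸ isLUB_Ioo hlr : IsLUB _ r).unique hlub
    subst this
    simp only [G, hi]
    -- For `x > 0` the lower endpoint is on `C₁`, and its contribution must be kept to be combined
    -- with that of `U`; for `x ≤ 0` its sign is enough.
    refine ⟨by linarith [hV_off _ hl], fun h => ?_⟩
    have hx : D.γ r ∈ Ioo (D.γ D.y₁) D.x₀ := hD.γ_image hσ ▸ mem_image_of_mem D.γ hy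
    have := (heq ▸ isGLB_Ioo hlr : IsGLB _ l).unique (hD.isGLB_slice_snd_C₁ ⟨h, hx.2⟩)
    rw [this]
  have hinjγ : InjOn D.γ (Ioo D.y₀ D.y₁) :=
    (hD.γ_strictAntiOn hσ).injOn.mono Ioo_subset_Icc_self
  have hderγ : ∀ y ∈ Ioo D.y₀ D.y₁,
      HasDerivWithinAt D.γ (-√(σ y - D.γ y)) (Ioo D.y₀ D.y₁) y :=
    fun y hy => (hD.γ_char y hy).hasDerivWithinAt
  have hinjg : InjOn D.g (Ioo 0 D.x₀) := hD.g_strictMonoOn.injOn.mono Ioo_subset_Icc_self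
  have hderg : ∀ x ∈ Ioo 0 D.x₀, HasDerivWithinAt D.g (deriv D.g x) (Ioo 0 D.x₀) x :=
    fun x hx => (hD.g_hasDerivAt hx).hasDerivWithinAt
  -- The two integrals over slices, split along the arcs.
  have hFsplit : ∫ y, F y = (∫ y in Ioo 0 D.y₀, F y) + ∫ y in Ioo D.y₀ D.y₁, F y := by
    have hF0 : ∀ y, y ∉ Ioo 0 D.y₁ → F y = 0 := fun y hy => by
      simp only [F, hD.slice_fst_eq_empty hy, Measure.restrict_empty, integral_zero_measure]
    rw [← setIntegral_eq_integral_of_forall_compl_eq_zero hF0,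
      ← integral_Ioc_eq_integral_Ioo, ← integral_Ioc_eq_integral_Ioo,
      ← integral_Ioc_eq_integral_Ioo, ← Ioc_union_Ioc_eq_Ioc hD.y₀_pos.le hD.y₀_lt_y₁.le,
      setIntegral_union (Ioc_disjoint_Ioc_of_le le_rfl) measurableSet_Ioc hi1.integrableOn
        hi1.integrableOn]
  have hGsupp : ∫ x, G x = ∫ x in Ioo (D.γ D.y₁) D.x₀, G x := by
    have hG0 : ∀ x, x ∉ Ioo (D.γ D.y₁) D.x₀ → G x = 0 := fun x hx => by
      simp only [G, hD.slice_snd_eq_empty hx, Measure.restrict_empty, integral_zero_measure]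
    rw [← setIntegral_eq_integral_of_forall_compl_eq_zero hG0]
  have hFg : ∫ y in Ioo 0 D.y₀, F y = ∫ x in Ioo 0 D.x₀, |deriv D.g x| • F (D.g x) := by
    rw [← hD.g_image]
    exact integral_image_eq_integral_abs_deriv_smul measurableSet_Ioo hderg hinjg F
  have hFgi : IntegrableOn (fun x => |deriv D.g x| • F (D.g x)) (Ioo 0 D.x₀) :=
    (integrableOn_image_iff_integrableOn_abs_deriv_smul measurableSet_Ioo hderg hinjg F).1
      hi1.integrableOn
  -- The trace of `V` on `Γ`, as a function of `x`.
  let θ : ℝ → ℝ := Function.invFunOn D.γ (Ioo D.y₀ D.y₁)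
  have hθ : ∀ y ∈ Ioo D.y₀ D.y₁, θ (D.γ y) = y := fun y hy => hinjγ.leftInvOn_invFunOn hy
  let v : ℝ → ℝ := fun x => V (x, θ x)
  have hcontΓ : ∀ f : ℝ × ℝ → ℝ, ContinuousOn f (closure D.region) →
      IntegrableOn (fun y => f (D.γ y, y)) (Ioo D.y₀ D.y₁) := by
    intro f hf
    have hcl : ∀ y ∈ Icc D.y₀ D.y₁, (D.γ y, y) ∈ closure D.region := by
      have hc : ContinuousOn (fun y => (D.γ y, y)) (closure (Ioo D.y₀ D.y₁)) := by
        rw [closure_Ioo hD.y₀_lt_y₁.ne]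
        exact hD.γ_cont.prodMk continuousOn_id
      have := hc.image_closure.trans (closure_mono (t := closure D.region)
        (image_subset_iff.2 fun y hy => (hFΓ y hy).1))
      rw [closure_Ioo hD.y₀_lt_y₁.ne, closure_closure] at this
      exact fun y hy => this (mem_image_of_mem _ hy)
    exact ((hf.comp (hD.γ_cont.prodMk continuousOn_id) hcl).integrableOn_Icc).mono_set
      Ioo_subset_Icc_self
  have hUΓ := hcontΓ U hU
  have hVΓ : IntegrableOn (fun y => √(σ y - D.γ y) * V (D.γ y, y)) (Ioo D.y₀ D.y₁) := by
    refine hcontΓ (fun z => √(σ z.2 - z.1) * V z) (ContinuousOn.mul ?_ hV)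
    have := hσ.contDiff.continuous
    fun_prop
  have habs : ∀ y ∈ Ioo D.y₀ D.y₁, |-√(σ y - D.γ y)| • v (D.γ y) =
      √(σ y - D.γ y) * V (D.γ y, y) := fun y hy => by
    simp only [v, hθ y hy, abs_neg, abs_of_nonneg (Real.sqrt_nonneg _), smul_eq_mul]
  have hvi : IntegrableOn v (Ioo (D.γ D.y₁) D.x₀) := by
    rw [← hD.γ_image hσ,
      integrableOn_image_iff_integrableOn_abs_deriv_smul measurableSet_Ioo hderγ hinjγ]
    exact hVΓ.congr_fun (fun y hy => (habs y hy).symm) measurableSet_Ioo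
  have hv : ∫ x in Ioo (D.γ D.y₁) D.x₀, v x =
      ∫ y in Ioo D.y₀ D.y₁, √(σ y - D.γ y) * V (D.γ y, y) := by
    rw [← hD.γ_image hσ,
      integral_image_eq_integral_abs_deriv_smul measurableSet_Ioo hderγ hinjγ]
    exact setIntegral_congr_fun measurableSet_Ioo habs
  have hγ₁ : D.γ D.y₁ ≤ 0 := by
    have := hD.c_bounds (t := 0) (by simp)
    exact this.1.trans this.2.1
  have hsub : Ioo 0 D.x₀ ⊆ Ioo (D.γ D.y₁) D.x₀ := Ioo_subset_Ioo_left hγ₁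
  -- The contribution of `Γ`.
  have part₁ : 0 ≤ (∫ y in Ioo D.y₀ D.y₁, F y) + ∫ x in Ioo (D.γ D.y₁) D.x₀, v x := by
    rw [hv, ← integral_add hi1.integrableOn hVΓ]
    refine setIntegral_nonneg measurableSet_Ioo fun y hy => ?_
    linarith [hΓ y hy, (hFΓ y hy).2]
  -- The contribution of `C₁` and `C₂`.
  have hGv : ∀ x ∈ Ioo (D.γ D.y₁) D.x₀, v x ≤ G x ∧ (0 < x → G x - v x = -V (x, D.g x)) := by
    rw [← hD.γ_image hσ]
    rintro _ ⟨y, hy, rfl⟩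
    simp only [v, hθ y hy]
    refine ⟨(hGΓ y hy).1, fun h => ?_⟩
    rw [(hGΓ y hy).2 h]
    ring
  have part₂ : 0 ≤ (∫ x in Ioo 0 D.x₀, |deriv D.g x| • F (D.g x)) +
      ∫ x in Ioo (D.γ D.y₁) D.x₀, (G x - v x) := by
    have hGvi : IntegrableOn (fun x => G x - v x) (Ioo (D.γ D.y₁) D.x₀) :=
      hi2.integrableOn.sub hvi
    -- The range `x ≤ 0`, where no lower endpoint lies on `C₁` away from the origin, contributes
    -- nonnegatively and is dropped.
    have hmono : ∫ x in Ioo 0 D.x₀, (G x - v x) ≤ ∫ x in Ioo (D.γ D.y₁) D.x₀, (G x - v x) := by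
      refine setIntegral_mono_set hGvi ?_ hsub.eventuallyLE
      filter_upwards [ae_restrict_mem measurableSet_Ioo] with x hx
      exact sub_nonneg.2 (hGv x hx).1
    refine le_trans ?_ (add_le_add_right hmono _)
    rw [← integral_add hFgi (hGvi.mono_set hsub)]
    refine setIntegral_nonneg measurableSet_Ioo fun x hx => ?_
    have hg := hD.g_deriv x hx
    obtain ⟨hfr, hle⟩ := hFC x hx
    rw [(hGv x (hsub hx)).2 hx.1, abs_of_pos hg, smul_eq_mul]
    have := mul_le_mul_of_nonneg_left hle hg.le
    linarith [hC₁ x hx hfr]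
  rw [integral_sub hi2.integrableOn hvi] at part₂
  rw [he1, he2, hFsplit, hGsupp, hFg]
  linarith

end Admissible
end Arcs
end ColdPlasma

/-! ### The energy estimate with general multipliers. -/

namespace ColdPlasma

theorem hasDerivAt_fst_of_hasFDerivAt {f : ℝ × ℝ → ℝ} {f' : ℝ × ℝ →L[ℝ] ℝ} {z : ℝ × ℝ}
    (h : HasFDerivAt f f' z) : HasDerivAt (fun x => f (x, z.2)) (f' (1, 0)) z.1 :=
  HasFDerivAt.comp_hasDerivAt (f := fun x => (x, z.2)) z.1 h
    ((hasDerivAt_id z.1).prodMk (hasDerivAt_const z.1 z.2))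

theorem hasDerivAt_snd_of_hasFDerivAt {f : ℝ × ℝ → ℝ} {f' : ℝ × ℝ →L[ℝ] ℝ} {z : ℝ × ℝ}
    (h : HasFDerivAt f f' z) : HasDerivAt (fun y => f (z.1, y)) (f' (0, 1)) z.2 :=
  HasFDerivAt.comp_hasDerivAt (f := fun y => (z.1, y)) z.2 h
    ((hasDerivAt_const z.2 z.1).prodMk (hasDerivAt_id z.2))

/-- A weighted form of the inequality between the arithmetic and the geometric mean. -/
theorem mul_add_mul_le_weighted {κ M s m₁ m₂ h₁ h₂ N : ℝ} (hκ : 0 < κ) (hM : 0 < M) (hs : 0 < s)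
    (hm : m₁ ^ 2 + m₂ ^ 2 ≤ M * N) :
    m₁ * h₁ + m₂ * h₂ ≤ κ / 2 * (s * N) + M / (2 * κ) * (1 / s * (h₁ ^ 2 + h₂ ^ 2)) := by
  have amgm : ∀ m h : ℝ, m * h ≤ κ / (2 * M) * s * m ^ 2 + M / (2 * κ) * (1 / s * h ^ 2) := by
    intro m h
    have : κ / (2 * M) * s * m ^ 2 + M / (2 * κ) * (1 / s * h ^ 2) - m * h =
        (κ * s * m - M * h) ^ 2 / (2 * κ * M * s) := by
      field_simp
      ring
    have h0 : 0 ≤ (κ * s * m - M * h) ^ 2 / (2 * κ * M * s) := by positivity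
    linarith
  have h1 : κ / (2 * M) * s * (m₁ ^ 2 + m₂ ^ 2) ≤ κ / 2 * (s * N) := by
    calc κ / (2 * M) * s * (m₁ ^ 2 + m₂ ^ 2) ≤ κ / (2 * M) * s * (M * N) := by gcongr
      _ = κ / 2 * (s * N) := by field_simp
  linarith [amgm m₁ h₁, amgm m₂ h₂]

namespace Arcs.Admissible

variable {D : Arcs} {σ a b : ℝ → ℝ} {p q ℓ δ : ℝ}

theorem snd_nonneg_of_mem_closure (hD : D.Admissible σ a b p q ℓ δ) {z : ℝ × ℝ}
    (hz : z ∈ closure D.region) : 0 ≤ z.2 :=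
  closure_minimal (s := D.region) (t := {z : ℝ × ℝ | 0 ≤ z.2}) (fun _ h => (hD.snd_pos h).le)
    (isClosed_le continuous_const continuous_snd) hz

/-- The a priori estimate for `L*`, given multipliers `A(y)`, `B(y)` for which the boundary terms
on `C₁` and `C₂` have the favourable sign and the quadratic form in the interior is coercive. -/
theorem exists_mul_lowerNorm_le_upperNorm (hσ : IsSonic σ) (hD : D.Admissible σ a b p q ℓ δ)
    {A B A' B' : ℝ → ℝ} {K κ : ℝ}
    (hA : ∀ y, HasDerivAt A (A' y) y) (hB : ∀ y, HasDerivAt B (B' y) y)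
    (hA' : Continuous A') (hB' : Continuous B')
    (hA_nonneg : ∀ y, 0 ≤ y → 0 ≤ A y) (hB_nonpos : ∀ y, 0 ≤ y → B y ≤ 0)
    (hC₁ : ∀ x ∈ Ioo 0 D.x₀, A (D.g x) * deriv D.g x + B (D.g x) ≤ 0) (hκ : 0 < κ)
    (hcoercive : ∀ z ∈ D.region, ∀ u v : ℝ, κ * (deriv σ z.2 * (u ^ 2 + v ^ 2)) ≤
      (A z.2 * (1 / 2 - K) + B' z.2 * (z.1 - σ z.2) / 2 - B z.2 * deriv σ z.2 / 2) * u ^ 2 +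
        (-K * B z.2 - A' z.2) * (u * v) + -(B' z.2) / 2 * v ^ 2) :
    ∃ k : ℝ, 0 < k ∧ ∀ w₁ w₂ : ℝ × ℝ → ℝ, IsTestPair σ K D w₁ w₂ →
      IntegrableOn (lowerDensity σ w₁ w₂) D.region ∧
      k * lowerNorm σ D.region w₁ w₂ ≤
        upperNorm σ D.region (adjoint₁ σ K w₁ w₂) (adjoint₂ w₁ w₂) := by
  have cσ : Continuous σ := hσ.contDiff.continuous
  have cσ' := hσ.continuous_deriv
  have cA : Continuous A := continuous_iff_continuousAt.2 fun y => (hA y).continuousAt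
  have cB : Continuous B := continuous_iff_continuousAt.2 fun y => (hB y).continuousAt
  -- The bounded quantity is the squared Frobenius norm of the multiplier matrix with rows `(A, B)`
  -- and `(-B T, A)`, where `T = x - σ(y)`.
  obtain ⟨M, hM, hbound⟩ : ∃ M, 0 < M ∧ ∀ z ∈ D.region,
      2 * A z.2 ^ 2 + B z.2 ^ 2 + (B z.2 * (z.1 - σ z.2)) ^ 2 ≤ M := by
    have hc : Continuous fun z : ℝ × ℝ =>
        2 * A z.2 ^ 2 + B z.2 ^ 2 + (B z.2 * (z.1 - σ z.2)) ^ 2 := by fun_prop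
    obtain ⟨M, hM⟩ := hD.isCompact_closure_region.bddAbove_image hc.continuousOn
    exact ⟨max M 1, by positivity, fun z hz =>
      (hM (mem_image_of_mem _ (subset_closure hz))).trans (le_max_left _ _)⟩
  -- The squared norms `I`, `J` will satisfy `κ/2 · I ≤ M/(2κ) · J`, which gives the constant
  -- `κ/√M`.
  refine ⟨√(κ ^ 2 / M), by positivity, fun w₁ w₂ hw => ?_⟩
  obtain ⟨c₁, d₁, cd₁, hd₁⟩ := hw.smooth₁
  obtain ⟨c₂, d₂, cd₂, hd₂⟩ := hw.smooth₂
  have hlower : IntegrableOn (lowerDensity σ w₁ w₂) D.region := by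
    refine hD.integrableOn_region ?_
    unfold lowerDensity
    fun_prop
  refine ⟨hlower, ?_⟩
  let T : ℝ × ℝ → ℝ := fun z => z.1 - σ z.2
  have cT : Continuous T := by fun_prop
  let U : ℝ × ℝ → ℝ := fun z =>
    A z.2 * T z * w₁ z ^ 2 + 2 * (B z.2 * T z * (w₁ z * w₂ z)) - A z.2 * w₂ z ^ 2
  let V : ℝ × ℝ → ℝ := fun z =>
    -(B z.2 * T z * w₁ z ^ 2) + 2 * (A z.2 * (w₁ z * w₂ z)) + B z.2 * w₂ z ^ 2
  let Ux : ℝ × ℝ → ℝ := fun z =>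
    A z.2 * (w₁ z ^ 2 + T z * (2 * w₁ z * d₁ z (1, 0))) +
      2 * (B z.2 * (w₁ z * w₂ z + T z * (d₁ z (1, 0) * w₂ z + w₁ z * d₂ z (1, 0)))) -
      A z.2 * (2 * w₂ z * d₂ z (1, 0))
  let Vy : ℝ × ℝ → ℝ := fun z =>
    -(B' z.2 * T z * w₁ z ^ 2 - B z.2 * deriv σ z.2 * w₁ z ^ 2 +
      B z.2 * T z * (2 * w₁ z * d₁ z (0, 1))) +
      2 * (A' z.2 * (w₁ z * w₂ z) + A z.2 * (d₁ z (0, 1) * w₂ z + w₁ z * d₂ z (0, 1))) +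
      (B' z.2 * w₂ z ^ 2 + B z.2 * (2 * w₂ z * d₂ z (0, 1)))
  have cU : ContinuousOn U (closure D.region) := by fun_prop
  have cV : ContinuousOn V (closure D.region) := by fun_prop
  have cUx : ContinuousOn Ux (closure D.region) := by fun_prop
  have cVy : ContinuousOn Vy (closure D.region) := by fun_prop
  have hUd : ∀ z ∈ D.region, HasDerivAt (fun x => U (x, z.2)) (Ux z) z.1 := by
    intro z hz
    have e₁ := hasDerivAt_fst_of_hasFDerivAt (hd₁ z hz)
    have e₂ := hasDerivAt_fst_of_hasFDerivAt (hd₂ z hz)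
    have eT : HasDerivAt (fun x => T (x, z.2)) 1 z.1 := (hasDerivAt_id' z.1).sub_const (σ z.2)
    have := ((((eT.const_mul (A z.2)).mul (e₁.pow 2)).add
      (((eT.const_mul (B z.2)).mul (e₁.mul e₂)).const_mul 2)).sub ((e₂.pow 2).const_mul (A z.2)))
    refine HasDerivAt.congr_deriv this ?_
    simp only [Ux, Pi.mul_apply, Pi.pow_apply, Prod.mk.eta]
    push_cast
    ring
  have hVd : ∀ z ∈ D.region, HasDerivAt (fun y => V (z.1, y)) (Vy z) z.2 := by
    intro z hz
    have e₁ := hasDerivAt_snd_of_hasFDerivAt (hd₁ z hz)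
    have e₂ := hasDerivAt_snd_of_hasFDerivAt (hd₂ z hz)
    have eT : HasDerivAt (fun y => T (z.1, y)) (-deriv σ z.2) z.2 :=
      (hσ.hasDerivAt z.2).const_sub _
    have := ((((hB z.2).mul eT).mul (e₁.pow 2)).neg.add
      (((hA z.2).mul (e₁.mul e₂)).const_mul 2)).add ((hB z.2).mul (e₂.pow 2))
    refine HasDerivAt.congr_deriv this ?_
    simp only [Vy, Pi.mul_apply, Pi.pow_apply, Prod.mk.eta]
    push_cast
    ring
  have hgreen : 0 ≤ ∫ z in D.region, (Ux z + Vy z) := by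
    refine hD.integral_divergence_nonneg hσ cU cUx cV cVy hUd hVd ?_ ?_ ?_ ?_
    · intro z hz
      have h0 := hA_nonneg z.2 (hD.snd_nonneg_of_mem_closure (frontier_subset_closure hz.1))
      simp only [U, hw.off_Γ z hz]
      nlinarith [mul_nonneg h0 (sq_nonneg (w₂ z))]
    · intro z hz
      have h0 := hB_nonpos z.2 (hD.snd_nonneg_of_mem_closure (frontier_subset_closure hz.1))
      simp only [V, hw.off_Γ z hz]
      nlinarith [mul_nonneg (neg_nonneg.2 h0) (sq_nonneg (w₂ z))]
    · intro x hx hz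
      simp only [U, V, hw.off_Γ _ hz]
      nlinarith [mul_nonneg (neg_nonneg.2 (hC₁ x hx)) (sq_nonneg (w₂ (x, D.g x)))]
    -- With `s = √(σ - γ)` one has `T = -s²` and `w₂ = s w₁`, so `U = -2s²(A + sB)w₁²` and `V = 2s(A
    -- + sB)w₁²`: the flux is zero whatever `A` and `B` are.
    · intro y hy
      have h := hw.on_Γ y hy
      rw [(hD.γ_char y hy).deriv] at h
      have hs := Real.sq_sqrt (sub_nonneg.2 (hD.γ_lt_sonic hσ hy).le)
      set s := √(σ y - D.γ y)
      have hT : T (D.γ y, y) = -s ^ 2 := by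
        simp only [T, hs]
        ring
      have h2 : w₂ (D.γ y, y) = s * w₁ (D.γ y, y) := by linarith
      simp only [U, V, hT, h2]
      exact le_of_eq (by ring)
  have hpoint : ∀ z ∈ D.region, (Ux z + Vy z) / 2 ≤
      -(κ / 2) * lowerDensity σ w₁ w₂ z +
        M / (2 * κ) * upperDensity σ (adjoint₁ σ K w₁ w₂) (adjoint₂ w₁ w₂) z := by
    intro z hz
    have hs : 0 < deriv σ z.2 := hσ.deriv_pos _ (hD.snd_pos hz)
    have hm : (A z.2 * w₁ z + B z.2 * w₂ z) ^ 2 + (-(B z.2 * T z) * w₁ z + A z.2 * w₂ z) ^ 2 ≤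
        M * (w₁ z ^ 2 + w₂ z ^ 2) := by
      refine le_trans ?_ (mul_le_mul_of_nonneg_right (hbound z hz) (by positivity))
      -- These squares are the defects in Cauchy-Schwarz for the two rows, by Lagrange's identity.
      nlinarith [sq_nonneg (A z.2 * w₂ z - B z.2 * w₁ z),
        sq_nonneg (A z.2 * w₁ z + B z.2 * T z * w₂ z)]
    have h1 := mul_add_mul_le_weighted (h₁ := adjoint₁ σ K w₁ w₂ z) (h₂ := adjoint₂ w₁ w₂ z)
      hκ hM hs hm
    have h2 := hcoercive z hz (w₁ z) (w₂ z)
    have h3 : (A z.2 * w₁ z + B z.2 * w₂ z) * adjoint₁ σ K w₁ w₂ z +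
        (-(B z.2 * T z) * w₁ z + A z.2 * w₂ z) * adjoint₂ w₁ w₂ z =
        (Ux z + Vy z) / 2 +
        ((A z.2 * (1 / 2 - K) + B' z.2 * (z.1 - σ z.2) / 2 - B z.2 * deriv σ z.2 / 2) * w₁ z ^ 2 +
        (-K * B z.2 - A' z.2) * (w₁ z * w₂ z) + -(B' z.2) / 2 * w₂ z ^ 2) := by
      simp only [adjoint₁, adjoint₂, partialX, partialY, (hd₁ z hz).fderiv, (hd₂ z hz).fderiv,
        Ux, Vy, T]
      ring
    simp only [lowerDensity, upperDensity]
    linarith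
  have hdiv : IntegrableOn (fun z => (Ux z + Vy z) / 2) D.region :=
    hD.integrableOn_region (by fun_prop)
  have hint := setIntegral_mono_on hdiv
    ((hlower.const_mul (-(κ / 2))).add (hw.finite.const_mul (M / (2 * κ))))
    hD.isOpen_region.measurableSet hpoint
  simp only [Pi.add_apply] at hint
  rw [integral_div, integral_add (hlower.const_mul _) (hw.finite.const_mul _),
    integral_const_mul, integral_const_mul] at hint
  rw [lowerNorm, upperNorm, ← Real.sqrt_mul (by positivity)]
  refine Real.sqrt_le_sqrt ?_
  set I := ∫ z in D.region, lowerDensity σ w₁ w₂ z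
  set J := ∫ z in D.region, upperDensity σ (adjoint₁ σ K w₁ w₂) (adjoint₂ w₁ w₂) z
  have h : κ / 2 * I ≤ M / (2 * κ) * J := by linarith
  calc κ ^ 2 / M * I = 2 * κ / M * (κ / 2 * I) := by ring
    _ ≤ 2 * κ / M * (M / (2 * κ) * J) := by gcongr
    _ = J := by field_simp

theorem fst_le (hD : D.Admissible σ a b p q ℓ δ) {z : ℝ × ℝ} (hz : z ∈ D.region) :
    z.1 ≤ ℓ - δ :=
  hD.isLUB_fst.1 (mem_image_of_mem _ hz)

end Arcs.Admissible
end ColdPlasma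

/-! ### Coercivity for the two choices of multipliers. -/

theorem lemma4 (σ a b : ℝ → ℝ) (K p q ℓ δ : ℝ) (D : ColdPlasma.Arcs)
    (hσ : ColdPlasma.IsSonic σ) (hD : D.Admissible σ a b p q ℓ δ)
    (hyp :
      (K ∈ Set.Icc (0 : ℝ) (1 / 2) ∧
        (∀ y, 0 ≤ y → a y = K * (y + ℓ⁻¹ * ∫ t in (0 : ℝ)..y, σ t)) ∧
        (∀ y, 0 ≤ y → b y = -(1 + σ y / ℓ))) ∨
      (K ∈ Set.Icc (0 : ℝ) 1 ∧
        (∀ y, 0 ≤ y → σ y = y ^ 2) ∧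
        (∀ y, 0 ≤ y → a y = K * y) ∧
        (∀ y, 0 ≤ y → b y = -(1 + σ y / (2 * ℓ))))) :
    ∃ k : ℝ, 0 < k ∧ ∀ w₁ w₂ : ℝ × ℝ → ℝ, ColdPlasma.IsTestPair σ K D w₁ w₂ →
      MeasureTheory.IntegrableOn (ColdPlasma.lowerDensity σ w₁ w₂) D.region ∧
      k * ColdPlasma.lowerNorm σ D.region w₁ w₂ ≤
        ColdPlasma.upperNorm σ D.region (ColdPlasma.adjoint₁ σ K w₁ w₂)
          (ColdPlasma.adjoint₂ w₁ w₂) := by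
  have hℓ := hD.ℓ_pos
  have hδ := hD.δ_pos
  have hg : ∀ x ∈ Ioo 0 D.x₀, 0 ≤ D.g x := fun x hx =>
    (hD.g_image ▸ mem_image_of_mem D.g hx : D.g x ∈ Ioo 0 D.y₀).1.le
  have cσ : Continuous σ := hσ.contDiff.continuous
  have cσ' := hσ.continuous_deriv
  rcases hyp with ⟨⟨hK0, hK1⟩, ha, hb⟩ | ⟨⟨hK0, hK1⟩, hsq, ha, hb⟩
  · have hA_nonneg : ∀ y, 0 ≤ y → 0 ≤ K * (y + ℓ⁻¹ * ∫ t in (0 : ℝ)..y, σ t) := fun y hy => by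
      have := intervalIntegral.integral_nonneg (μ := volume) hy
        fun t (ht : t ∈ Icc 0 y) => hσ.nonneg ht.1
      positivity
    refine hD.exists_mul_lowerNorm_le_upperNorm hσ (K := K)
      (A := fun y => K * (y + ℓ⁻¹ * ∫ t in (0 : ℝ)..y, σ t)) (B := fun y => -(1 + σ y / ℓ))
      (A' := fun y => K * (1 + ℓ⁻¹ * σ y)) (B' := fun y => -(deriv σ y / ℓ))
      -- The coefficient of `u²` is at least `δσ'/(2ℓ)`, by `x ≤ ℓ - δ` and `K ≤ 1/2`; that of `v²`
      -- is exactly `σ'/(2ℓ)`.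
      (κ := min (δ / (2 * ℓ)) (1 / (2 * ℓ)))
      (fun y => ?_) (fun y => ?_) (by fun_prop) (by fun_prop) hA_nonneg (fun y hy => ?_)
      (fun x hx => ?_) (by positivity) fun z hz u v => ?_
    · exact ((hasDerivAt_id y).add ((cσ.integral_hasStrictDerivAt 0 y).hasDerivAt.const_mul
        ℓ⁻¹)).const_mul K
    · exact (((hσ.hasDerivAt y).div_const ℓ).const_add 1).neg
    · have := hσ.nonneg hy
      have : 0 ≤ σ y / ℓ := by positivity
      linarith
    · have := hD.g_cond x hx
      rw [ha _ (hg x hx), hb _ (hg x hx)] at this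
      exact this.le
    · have hy := hD.snd_pos hz
      have hs := hσ.deriv_pos _ hy
      have hσy := hσ.nonneg hy.le
      have hx := hD.fst_le hz
      have h1 := mul_nonneg (hA_nonneg z.2 hy.le) (sub_nonneg.2 hK1)
      have hu : min (δ / (2 * ℓ)) (1 / (2 * ℓ)) * deriv σ z.2 * u ^ 2 ≤
          δ / (2 * ℓ) * deriv σ z.2 * u ^ 2 := by gcongr; exact min_le_left _ _
      have hv : min (δ / (2 * ℓ)) (1 / (2 * ℓ)) * deriv σ z.2 * v ^ 2 ≤
          1 / (2 * ℓ) * deriv σ z.2 * v ^ 2 := by gcongr; exact min_le_right _ _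
      have h2 : δ / (2 * ℓ) * deriv σ z.2 ≤
          -(deriv σ z.2 / ℓ) * (z.1 - σ z.2) / 2 - -(1 + σ z.2 / ℓ) * deriv σ z.2 / 2 := by
        have : -(deriv σ z.2 / ℓ) * (z.1 - σ z.2) / 2 - -(1 + σ z.2 / ℓ) * deriv σ z.2 / 2 -
            δ / (2 * ℓ) * deriv σ z.2 =
            deriv σ z.2 * (ℓ - δ - z.1 + 2 * σ z.2) / (2 * ℓ) := by
          field_simp
          ring
        have h0 : 0 ≤ deriv σ z.2 * (ℓ - δ - z.1 + 2 * σ z.2) / (2 * ℓ) := by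
          have : 0 ≤ ℓ - δ - z.1 + 2 * σ z.2 := by linarith
          positivity
        linarith
      have h3 := mul_le_mul_of_nonneg_right h2 (sq_nonneg u)
      have h4 := mul_nonneg h1 (sq_nonneg u)
      -- The integral term in `a` is there to give `A' = -K B`, which removes the cross term.
      have h5 : (-K * -(1 + σ z.2 / ℓ) - K * (1 + ℓ⁻¹ * σ z.2)) * (u * v) = 0 := by ring
      have h6 : - -(deriv σ z.2 / ℓ) / 2 * v ^ 2 = 1 / (2 * ℓ) * deriv σ z.2 * v ^ 2 := by ring
      rw [h5, h6]
      linarith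
  · refine hD.exists_mul_lowerNorm_le_upperNorm hσ (K := K)
      (A := fun y => K * y) (B := fun y => -(1 + σ y / (2 * ℓ)))
      (A' := fun _ => K) (B' := fun y => -(deriv σ y / (2 * ℓ)))
      -- The coefficient of `v²` is `σ'/(4ℓ)`; half of it is reserved for absorbing the cross term.
      (κ := min (δ / (4 * ℓ)) (1 / (8 * ℓ)))
      (fun y => ?_) (fun y => ?_) (by fun_prop) (by fun_prop) (fun y hy => by positivity)
      (fun y hy => ?_) (fun x hx => ?_) (by positivity) fun z hz u v => ?_
    · simpa using (hasDerivAt_id y).const_mul K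
    · exact (((hσ.hasDerivAt y).div_const (2 * ℓ)).const_add 1).neg
    · have := hσ.nonneg hy
      have : 0 ≤ σ y / (2 * ℓ) := by positivity
      linarith
    · have := hD.g_cond x hx
      rw [ha _ (hg x hx), hb _ (hg x hx)] at this
      exact this.le
    · have hy := hD.snd_pos hz
      have hds : deriv σ z.2 = 2 * z.2 := by
        have : σ =ᶠ[nhds z.2] fun y => y ^ 2 := by
          filter_upwards [lt_mem_nhds hy] with y hy
          exact hsq y hy.le
        rw [this.deriv_eq]
        simp
      have hx := hD.fst_le hz
      simp only [hds, hsq _ hy.le]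
      set y := z.2
      set x := z.1
      have hu : min (δ / (4 * ℓ)) (1 / (8 * ℓ)) * (2 * y) * u ^ 2 ≤
          δ / (4 * ℓ) * (2 * y) * u ^ 2 := by gcongr; exact min_le_left _ _
      have hv : min (δ / (4 * ℓ)) (1 / (8 * ℓ)) * (2 * y) * v ^ 2 ≤
          1 / (8 * ℓ) * (2 * y) * v ^ 2 := by gcongr; exact min_le_right _ _
      -- The difference of the two sides is `(1 - K)(K + 1/2)`. For `K > 1/2` the loss is thus at
      -- most `y/2`, half of the leading part `y` of `-Bσ'/2`.
      have hKK : -(1 / 2) ≤ K * (1 / 2 - K) := by nlinarith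
      have h1 : 0 ≤ K * y * (1 / 2 - K) + y / 2 := by nlinarith
      have h2 : y * (y ^ 2 / ℓ) * u ^ 2 + δ / (4 * ℓ) * (2 * y) * u ^ 2 ≤
          (K * y * (1 / 2 - K) + -(2 * y / (2 * ℓ)) * (x - y ^ 2) / 2 -
            -(1 + y ^ 2 / (2 * ℓ)) * (2 * y) / 2) * u ^ 2 := by
        rw [← add_mul]
        refine mul_le_mul_of_nonneg_right ?_ (sq_nonneg u)
        have : K * y * (1 / 2 - K) + -(2 * y / (2 * ℓ)) * (x - y ^ 2) / 2 -
            -(1 + y ^ 2 / (2 * ℓ)) * (2 * y) / 2 =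
            K * y * (1 / 2 - K) + y / 2 + (y * (y ^ 2 / ℓ) + δ / (4 * ℓ) * (2 * y)) +
            y * (ℓ - δ - x) / (2 * ℓ) := by
          field_simp
          ring
        have h0 : 0 ≤ y * (ℓ - δ - x) / (2 * ℓ) := by
          have : 0 ≤ ℓ - δ - x := by linarith
          positivity
        linarith
      -- The cross term `K y² uv/(2ℓ)` is absorbed by the spare `y³u²/ℓ` and half of the `v²` term:
      -- the sum is `y/(4ℓ)` times `v² + 2K(yu)v + 4(yu)²`, which is nonnegative as `K ≤ 1`.
      have h3 : -(y * (y ^ 2 / ℓ) * u ^ 2) - 1 / (4 * ℓ) * y * v ^ 2 ≤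
          (-K * -(1 + y ^ 2 / (2 * ℓ)) - K) * (u * v) := by
        have : (-K * -(1 + y ^ 2 / (2 * ℓ)) - K) * (u * v) -
            (-(y * (y ^ 2 / ℓ) * u ^ 2) - 1 / (4 * ℓ) * y * v ^ 2) =
            y / (4 * ℓ) * ((v + K * (y * u)) ^ 2 + (4 - K ^ 2) * (y * u) ^ 2) := by
          field_simp
          ring
        have h0 : 0 ≤ y / (4 * ℓ) * ((v + K * (y * u)) ^ 2 + (4 - K ^ 2) * (y * u) ^ 2) := by
          have : 0 ≤ 4 - K ^ 2 := by nlinarith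
          positivity
        linarith
      have h4 : - -(2 * y / (2 * ℓ)) / 2 * v ^ 2 =
          1 / (8 * ℓ) * (2 * y) * v ^ 2 + 1 / (4 * ℓ) * y * v ^ 2 := by
        field_simp
        ring
      rw [h4]
      linarith
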